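/- Let $\nu,\kappa$ be infinite cardinals such that $\kappa^{<\kappa}=\kappa$ and $\nu>\kappa$. Let $\mathrm{Fn}_{<\kappa}(\nu\times\kappa,\kappa)$ be the poset of all functions $p\subseteq(\nu\times\kappa)\times\kappa$ with $|p|<\kappa$, ordered by reverse inclusion. Then $$\mathrm{Fn}_{<\kappa}(\nu\times\kappa,\kappa)\Vdash\mathfrak{d}_\kappa\geq\nu,$$ where, for $f,g\in\kappa^\kappa$, $f\leq^* g$ means $\exists\alpha<\kappa\,\forall\beta>\alpha\,(f(\beta)\leq g(\beta))$, and $$\mathfrak{d}_\kappa=\min\{|D| : D\subseteq\kappa^\kappa \text{ and } \forall g\in\kappa^\kappa\,\exists f\in D\,(g\leq^* f)\}.$$ -/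

import Mathlib

open Cardinal

universe u v

namespace KappaCohen

/-! ### Formulas of the language of set theory with parameters -/

/-- Formulas of the language `{∈, =}` of set theory with parameters from `M`. A quantified formula
is given by its instances, so that all variables are bound or replaced by parameters. -/
inductive SetFormula (M : Type v) : Type v
  | mem (x y : M) : SetFormula M
  | eq (x y : M) : SetFormula M
  | neg (φ : SetFormula M) : SetFormula M
  | conj (φ ψ : SetFormula M) : SetFormula M
  | all (φ : M → SetFormula M) : SetFormula M

namespace SetFormula

variable {M : Type v}

/-- `φ ∨ ψ` -/
def disj (φ ψ : SetFormula M) : SetFormula M := neg (conj (neg φ) (neg ψ))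

/-- `φ → ψ` -/
def imp (φ ψ : SetFormula M) : SetFormula M := neg (conj φ (neg ψ))

/-- `φ ↔ ψ` -/
def biimp (φ ψ : SetFormula M) : SetFormula M := conj (imp φ ψ) (imp ψ φ)

/-- `∃ x, φ x` -/
def ex (φ : M → SetFormula M) : SetFormula M := neg (all fun x => neg (φ x))

/-- `∀ x ∈ a, φ x` -/
def allIn (a : M) (φ : M → SetFormula M) : SetFormula M := all fun x => imp (mem x a) (φ x)

/-- `∃ x ∈ a, φ x` -/
def exIn (a : M) (φ : M → SetFormula M) : SetFormula M := ex fun x => conj (mem x a) (φ x)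

/-- `z = {x, y}` -/
def isPair (z x y : M) : SetFormula M :=
  all fun w => biimp (mem w z) (disj (eq w x) (eq w y))

/-- `z = (x, y) = {{x}, {x, y}}` -/
def isOrdPair (z x y : M) : SetFormula M :=
  ex fun a => ex fun b => conj (isPair a x x) (conj (isPair b x y) (isPair z a b))

/-- `(x, y) ∈ f`, which reads `f(x) = y` when `f` is a function -/
def maps (f x y : M) : SetFormula M := exIn f fun z => isOrdPair z x y

/-- `f` is a function from `A` to `B` -/
def isFun (f A B : M) : SetFormula M :=
  conj (allIn f fun z => exIn A fun x => exIn B fun y => isOrdPair z x y)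
    (conj (allIn A fun x => exIn B fun y => maps f x y)
      (all fun x => all fun y => all fun w => imp (maps f x y) (imp (maps f x w) (eq y w))))

/-- `f ≤* g` for functions `f, g : κ → κ` on an ordinal `κ`:
`∃ α < κ, ∀ β < κ, β > α → f(β) ≤ g(β)` -/
def leStar (κ f g : M) : SetFormula M :=
  exIn κ fun α => allIn κ fun β => imp (mem α β)
    (all fun y => all fun z => imp (maps f β y) (imp (maps g β z) (disj (mem y z) (eq y z))))

/-- `D` is a dominating family in `κ^κ`:
`D ⊆ κ^κ` and every `g ∈ κ^κ` satisfies `g ≤* f` for some `f ∈ D` -/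
def isDominating (κ D : M) : SetFormula M :=
  conj (allIn D fun f => isFun f κ κ)
    (all fun g => imp (isFun g κ κ) (exIn D fun f => leStar κ g f))

/-- `|D| < ν` for an ordinal `ν`: some `θ < ν` is mapped onto `D` -/
def cardLT (D ν : M) : SetFormula M :=
  exIn ν fun θ => ex fun h =>
    conj (isFun h θ D) (allIn D fun y => exIn θ fun x => maps h x y)

/-- `𝔡_κ ≥ ν`, where `𝔡_κ` is the minimum of `|D|` over all dominating families `D` in `κ^κ`:
no dominating family in `κ^κ` has cardinality less than `ν` -/
def dominatingNumberGE (κ ν : M) : SetFormula M :=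
  all fun D => imp (isDominating κ D) (neg (cardLT D ν))

end SetFormula

/-! ### Names and the forcing relation -/

/-- `P`-names: a `P`-name is a set, indexed by a type of the ground universe, of pairs
`(τ, p)` of a `P`-name `τ` and a condition `p`. -/
inductive Name (P : Type u) : Type (u + 1)
  | mk (ι : Type u) (elt : ι → Name P) (cond : ι → P) : Name P

namespace Name

variable {P : Type u}

/-- The canonical name `{(y̌, p) : y ∈ x, p ∈ P}` of a set `x` of the ground universe. -/
def check : PSet.{u} → Name P
  | ⟨ι, A⟩ => ⟨ι × P, fun i => check (A i.1), fun i => i.2⟩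

/-- `p ⊩ x = y`, by recursion on names: whenever `(σ, s) ∈ x`, every `q ≤ p, s` forces `σ ∈ y`,
and symmetrically. Here `σ ∈ y` is forced below `p` if densely many `r` admit
`(τ, t) ∈ y` with `r ≤ t` and `r ⊩ σ = τ`. -/
def ForcesEq [Preorder P] : Name P → Name P → P → Prop
  | ⟨_, A, c⟩, ⟨_, B, d⟩ => fun p =>
    (∀ i, ∀ q ≤ p, q ≤ c i → ∃ r ≤ q, ∃ j, r ≤ d j ∧ ForcesEq (A i) (B j) r) ∧
    (∀ j, ∀ q ≤ p, q ≤ d j → ∃ r ≤ q, ∃ i, r ≤ c i ∧ ForcesEq (A i) (B j) r)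

/-- `p ⊩ x ∈ y`: the set of `r` for which there is `(τ, t) ∈ y` with `r ≤ t` and `r ⊩ x = τ`
is dense below `p`. -/
def ForcesMem [Preorder P] (x : Name P) : Name P → P → Prop
  | ⟨_, B, d⟩ => fun p => ∀ q ≤ p, ∃ r ≤ q, ∃ j, r ≤ d j ∧ ForcesEq x (B j) r

end Name

/-- The forcing relation `p ⊩ φ` for formulas whose parameters are `P`-names; quantifiers range
over all `P`-names. -/
def Forces {P : Type u} [Preorder P] : P → SetFormula (Name P) → Prop
  | p, .mem x y => Name.ForcesMem x y p
  | p, .eq x y => Name.ForcesEq x y p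
  | p, .neg φ => ∀ q ≤ p, ¬ Forces q φ
  | p, .conj φ ψ => Forces p φ ∧ Forces p ψ
  | p, .all φ => ∀ x, Forces p (φ x)

/-- `P ⊩ φ`: every condition of `P` forces `φ`. -/
def PosetForces (P : Type u) [Preorder P] (φ : SetFormula (Name P)) : Prop :=
  ∀ p : P, Forces p φ

/-! ### The poset of partial functions of size less than `κ` -/

/-- `Fn_{<κ}(I, J)`: the sets `p ⊆ I × J` that are functions and have fewer than `κ` elements. -/
def Fn (κ : Cardinal.{u}) (I J : Type u) : Type u :=
  {p : Set (I × J) // #p < κ ∧ ∀ i j j', (i, j) ∈ p → (i, j') ∈ p → j = j'}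

/-- `Fn_{<κ}(I, J)` is ordered by reverse inclusion: `q ≤ p` means `p ⊆ q`. -/
instance (κ : Cardinal.{u}) (I J : Type u) : PartialOrder (Fn κ I J) where
  le q p := p.1 ⊆ q.1
  le_refl _ := subset_rfl
  le_trans _ _ _ h₁ h₂ := h₂.trans h₁
  le_antisymm _ _ h₁ h₂ := Subtype.ext (h₂.antisymm h₁)

/-- The name of a cardinal of the ground universe, as an initial (von Neumann) ordinal. -/
noncomputable def cardName (P : Type u) (c : Cardinal.{u}) : Name P := Name.check c.ord.toPSet

end KappaCohen

/-! A small family of functions mentions too few coordinates to dominate all the Cohen functions.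
Suppose a condition forces that `h` maps an ordinal `a < ν` onto a dominating family `D`. For `i <
a` and `β < κ`, the conditions deciding the value `h(i)(β)` have a support of at most `κ` indices
(`Fn.exists_support`). All these supports together involve at most `max(|a|, κ) < ν` first
coordinates, so some `γ < ν` is not involved (`exists_index_off_supports`).

The generic function `g` with index `γ` is not dominated by any `f = h(i)`. Given a condition and a
bound `α`, take `β > α` at which `g` is undecided. Decide `f(β) = d` without deciding `g(β)`, and
then add the value `g(β) = d + 1` (`not_forces_leStar_genericFun`).

The support replaces a maximal antichain and the `κ⁺`-chain condition. It is obtained by closing off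
under a choice of extensions in `κ` steps, where `κ^{<κ} = κ` gives both the size bound and the
regularity of `κ`. -/

namespace KappaCohen

/-! ### Forced equality and membership of names -/

namespace Name

variable {P : Type u}

variable (P) in
/-- The canonical name of an ordinal of the ground universe. -/
noncomputable def ordName (o : Ordinal.{u}) : Name P := check o.toPSet

theorem ordName_eq (o : Ordinal.{u}) : ordName P o =
    mk (o.ToType × P) (fun i => ordName P (i.1.toOrd : Ordinal)) fun i => i.2 := by
  rw [ordName, Ordinal.toPSet, check]
  rfl

variable [Preorder P]

theorem forcesEq_mk {ι ι' : Type u} {A : ι → Name P} {c : ι → P} {B : ι' → Name P} {d : ι' → P}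
    {p : P} : ForcesEq (mk ι A c) (mk ι' B d) p ↔
      (∀ i, ∀ q ≤ p, q ≤ c i → ∃ r ≤ q, ∃ j, r ≤ d j ∧ ForcesEq (A i) (B j) r) ∧
      (∀ j, ∀ q ≤ p, q ≤ d j → ∃ r ≤ q, ∃ i, r ≤ c i ∧ ForcesEq (A i) (B j) r) := by
  rw [ForcesEq]

theorem forcesMem_mk {x : Name P} {ι : Type u} {B : ι → Name P} {d : ι → P} {p : P} :
    ForcesMem x (mk ι B d) p ↔ ∀ q ≤ p, ∃ r ≤ q, ∃ j, r ≤ d j ∧ ForcesEq x (B j) r :=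
  Iff.rfl

theorem ForcesEq.mono {x y : Name P} {p q : P} (h : ForcesEq x y p) (hq : q ≤ p) :
    ForcesEq x y q := by
  cases x; cases y
  rw [forcesEq_mk] at h ⊢
  exact ⟨fun i r hr => h.1 i r (hr.trans hq), fun i r hr => h.2 i r (hr.trans hq)⟩

theorem ForcesEq.of_dense {x y : Name P} {p : P} (h : ∀ q ≤ p, ∃ r ≤ q, ForcesEq x y r) :
    ForcesEq x y p := by
  cases x; cases y
  rw [forcesEq_mk]
  constructor
  · intro i q hq hc
    obtain ⟨r, hr, e⟩ := h q hq
    obtain ⟨s, hs, j, h1, h2⟩ := (forcesEq_mk.1 e).1 i r le_rfl (hr.trans hc)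
    exact ⟨s, hs.trans hr, j, h1, h2⟩
  · intro i q hq hc
    obtain ⟨r, hr, e⟩ := h q hq
    obtain ⟨s, hs, j, h1, h2⟩ := (forcesEq_mk.1 e).2 i r le_rfl (hr.trans hc)
    exact ⟨s, hs.trans hr, j, h1, h2⟩

theorem ForcesEq.refl (x : Name P) (p : P) : ForcesEq x x p := by
  induction x generalizing p with
  | mk ι A c ih =>
    rw [forcesEq_mk]
    exact ⟨fun i q _ hc => ⟨q, le_rfl, i, hc, ih i q⟩, fun i q _ hc => ⟨q, le_rfl, i, hc, ih i q⟩⟩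

theorem ForcesEq.symm {x y : Name P} {p : P} (h : ForcesEq x y p) : ForcesEq y x p := by
  induction x generalizing y p with
  | mk ι A c ih =>
    cases y
    rw [forcesEq_mk] at h ⊢
    constructor
    · intro i q hq hc
      obtain ⟨r, hr, j, h1, h2⟩ := h.2 i q hq hc
      exact ⟨r, hr, j, h1, ih j h2⟩
    · intro i q hq hc
      obtain ⟨r, hr, j, h1, h2⟩ := h.1 i q hq hc
      exact ⟨r, hr, j, h1, ih i h2⟩

theorem ForcesEq.trans {x y z : Name P} {p : P} (h : ForcesEq x y p) (h' : ForcesEq y z p) :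
    ForcesEq x z p := by
  induction x generalizing y z p with
  | mk ι A c ih =>
    cases y; cases z
    rw [forcesEq_mk] at h h' ⊢
    constructor
    · intro i q hq hc
      obtain ⟨r, hr, j, h1, h2⟩ := h.1 i q hq hc
      obtain ⟨s, hs, k, h3, h4⟩ := h'.1 j r (hr.trans hq) h1
      exact ⟨s, hs.trans hr, k, h3, ih i (h2.mono hs) h4⟩
    · intro i q hq hc
      obtain ⟨r, hr, j, h1, h2⟩ := h'.2 i q hq hc
      obtain ⟨s, hs, k, h3, h4⟩ := h.2 j r (hr.trans hq) h1
      exact ⟨s, hs.trans hr, k, h3, ih k h4 (h2.mono hs)⟩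

theorem ForcesMem.mono {x y : Name P} {p q : P} (h : ForcesMem x y p) (hq : q ≤ p) :
    ForcesMem x y q := by
  cases y
  exact fun r hr => h r (hr.trans hq)

theorem ForcesMem.of_dense {x y : Name P} {p : P} (h : ∀ q ≤ p, ∃ r ≤ q, ForcesMem x y r) :
    ForcesMem x y p := by
  cases y
  intro q hq
  obtain ⟨r, hr, e⟩ := h q hq
  obtain ⟨s, hs, j, hj⟩ := e r le_rfl
  exact ⟨s, hs.trans hr, j, hj⟩

theorem ForcesMem.congr_left {x x' y : Name P} {p : P} (h : ForcesMem x y p)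
    (e : ForcesEq x x' p) : ForcesMem x' y p := by
  cases y
  intro q hq
  obtain ⟨r, hr, j, hj, h'⟩ := h q hq
  exact ⟨r, hr, j, hj, (e.mono (hr.trans hq)).symm.trans h'⟩

theorem ForcesMem.congr_right {x y y' : Name P} {p : P} (h : ForcesMem x y p)
    (e : ForcesEq y y' p) : ForcesMem x y' p := by
  cases y; cases y'
  rw [forcesEq_mk] at e
  intro q hq
  obtain ⟨r, hr, j, hj, h'⟩ := h q hq
  obtain ⟨s, hs, k, hk, h''⟩ := e.1 j r (hr.trans hq) hj
  exact ⟨s, hs.trans hr, k, hk, (h'.mono hs).trans h''⟩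

theorem forcesMem_elt {ι : Type u} {B : ι → Name P} {d : ι → P} {p : P} (i : ι) (h : p ≤ d i) :
    ForcesMem (B i) (mk ι B d) p :=
  fun q hq => ⟨q, le_rfl, i, hq.trans h, .refl _ _⟩

/-! ### Names of ordinals -/

theorem forcesMem_ordName {x : Name P} {o : Ordinal.{u}} {p : P} :
    ForcesMem x (ordName P o) p ↔ ∀ q ≤ p, ∃ r ≤ q, ∃ a < o, ForcesEq x (ordName P a) r := by
  rw [ordName_eq, forcesMem_mk]
  refine forall₂_congr fun q _ => exists_congr fun r => and_congr_right fun _ => ?_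
  constructor
  · rintro ⟨j, -, h⟩
    exact ⟨_, j.1.toOrd.2, h⟩
  · rintro ⟨a, ha, h⟩
    exact ⟨(Ordinal.ToType.mk ⟨a, ha⟩, r), le_rfl, by simpa using h⟩

theorem forcesMem_ordName_of_lt {a o : Ordinal.{u}} (h : a < o) (p : P) :
    ForcesMem (ordName P a) (ordName P o) p :=
  forcesMem_ordName.2 fun q _ => ⟨q, le_rfl, a, h, .refl _ _⟩

/-- Induction on `a`: a member `c` of one side is forced into the other, so some extension forces it
equal to a canonical name there, and the induction hypothesis identifies the two ordinals. -/
theorem ForcesEq.ordName_inj {a b : Ordinal.{u}} {p : P}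
    (h : ForcesEq (ordName P a) (ordName P b) p) : a = b := by
  induction a using WellFoundedLT.induction generalizing b p with
  | ind a ih =>
    apply le_antisymm
    · refine le_of_forall_lt fun c hc => ?_
      obtain ⟨r, -, d, hd, e⟩ :=
        forcesMem_ordName.1 ((forcesMem_ordName_of_lt hc p).congr_right h) p le_rfl
      rwa [ih c hc e]
    · refine le_of_forall_lt fun c hc => ?_
      obtain ⟨r, -, d, hd, e⟩ :=
        forcesMem_ordName.1 ((forcesMem_ordName_of_lt hc p).congr_right h.symm) p le_rfl
      rwa [← ih d hd e.symm]

theorem ForcesMem.lt_of_ordName {a b : Ordinal.{u}} {p : P}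
    (h : ForcesMem (ordName P a) (ordName P b) p) : a < b := by
  obtain ⟨r, -, d, hd, e⟩ := forcesMem_ordName.1 h p le_rfl
  rwa [e.ordName_inj]

end Name

/-! ### The forcing relation and the connectives -/

section Forces

open SetFormula Name

variable {P : Type u} [Preorder P] {p q : P} {φ ψ : SetFormula (Name P)}
  {Φ : Name P → SetFormula (Name P)}

theorem Forces.mono (h : Forces p φ) (hq : q ≤ p) : Forces q φ := by
  induction φ generalizing p q with
  | mem x y => exact Name.ForcesMem.mono h hq
  | eq x y => exact Name.ForcesEq.mono h hq
  | neg φ _ => exact fun r hr => h r (hr.trans hq)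
  | conj φ ψ ih₁ ih₂ => exact ⟨ih₁ h.1 hq, ih₂ h.2 hq⟩
  | all φ ih => exact fun x => ih x (h x) hq

/-- Atomic formulas are defined by density and existence is a negated universal, so the conditions
forcing a formula are determined by any dense set of extensions. -/
theorem Forces.of_dense (h : ∀ q ≤ p, ∃ r ≤ q, Forces r φ) : Forces p φ := by
  induction φ generalizing p with
  | mem x y => exact Name.ForcesMem.of_dense h
  | eq x y => exact Name.ForcesEq.of_dense h
  | neg φ _ =>
    intro q hq hφ
    obtain ⟨r, hr, h'⟩ := h q hq
    exact h' r le_rfl (hφ.mono hr)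
  | conj φ ψ ih₁ ih₂ =>
    exact ⟨ih₁ fun q hq => (h q hq).imp fun _ h => ⟨h.1, h.2.1⟩,
      ih₂ fun q hq => (h q hq).imp fun _ h => ⟨h.1, h.2.2⟩⟩
  | all φ ih => exact fun x => ih x fun q hq => (h q hq).imp fun _ h => ⟨h.1, h.2 x⟩

theorem forces_conj : Forces p (conj φ ψ) ↔ Forces p φ ∧ Forces p ψ := Iff.rfl

theorem forces_all : Forces p (all Φ) ↔ ∀ x, Forces p (Φ x) := Iff.rfl

theorem forces_neg_neg : Forces p (neg (neg φ)) ↔ Forces p φ := by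
  constructor
  · intro h
    refine .of_dense fun q hq => ?_
    have := h q hq
    simp only [Forces] at this
    push Not at this
    exact this
  · exact fun h q hq h' => h' q le_rfl (h.mono hq)

theorem forces_imp : Forces p (imp φ ψ) ↔ ∀ q ≤ p, Forces q φ → Forces q ψ := by
  constructor
  · intro h q hq hφ
    rw [← forces_neg_neg]
    exact fun r hr h' => h r (hr.trans hq) ⟨hφ.mono hr, h'⟩
  · exact fun h q hq h' => h'.2 q le_rfl (h q hq h'.1)

theorem forces_disj :
    Forces p (disj φ ψ) ↔ ∀ q ≤ p, ∃ r ≤ q, Forces r φ ∨ Forces r ψ := by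
  constructor
  · intro h q hq
    by_contra! h'
    exact h q hq ⟨fun r hr => (h' r hr).1, fun r hr => (h' r hr).2⟩
  · intro h q hq h'
    obtain ⟨r, hr, h | h⟩ := h q hq
    · exact h'.1 r hr h
    · exact h'.2 r hr h

theorem forces_biimp :
    Forces p (biimp φ ψ) ↔ ∀ q ≤ p, (Forces q φ ↔ Forces q ψ) := by
  rw [biimp, forces_conj, forces_imp, forces_imp]
  exact ⟨fun h q hq => ⟨h.1 q hq, h.2 q hq⟩, fun h => ⟨fun q hq => (h q hq).1, fun q hq => (h q hq).2⟩⟩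

theorem forces_ex : Forces p (ex Φ) ↔ ∀ q ≤ p, ∃ r ≤ q, ∃ x, Forces r (Φ x) := by
  constructor
  · intro h q hq
    by_contra! h'
    exact h q hq fun x r hr => h' r hr x
  · intro h q hq h'
    obtain ⟨r, hr, x, hx⟩ := h q hq
    exact h' x r hr hx

theorem Forces.ex {x : Name P} (h : Forces p (Φ x)) : Forces p (ex Φ) :=
  forces_ex.2 fun q hq => ⟨q, le_rfl, x, h.mono hq⟩

theorem forces_allIn {a : Name P} :
    Forces p (allIn a Φ) ↔ ∀ x, ∀ q ≤ p, ForcesMem x a q → Forces q (Φ x) :=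
  forall_congr' fun _ => forces_imp

theorem forces_exIn {a : Name P} : Forces p (exIn a Φ) ↔
    ∀ q ≤ p, ∃ r ≤ q, ∃ x, ForcesMem x a r ∧ Forces r (Φ x) :=
  forces_ex

theorem Forces.exIn {a x : Name P} (h : ForcesMem x a p) (h' : Forces p (Φ x)) :
    Forces p (exIn a Φ) :=
  .ex (x := x) ⟨h, h'⟩

/-! ### Pairs -/

theorem forces_isPair {z x y : Name P} : Forces p (isPair z x y) ↔ ∀ w, ∀ q ≤ p,
    (ForcesMem w z q ↔ ∀ r ≤ q, ∃ s ≤ r, ForcesEq w x s ∨ ForcesEq w y s) := by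
  rw [isPair, forces_all]
  simp only [forces_biimp, forces_disj]
  rfl

theorem Forces.isPair_congr {z x y z' x' y' : Name P} (h : Forces p (isPair z x y))
    (hz : ForcesEq z z' p) (hx : ForcesEq x x' p) (hy : ForcesEq y y' p) :
    Forces p (isPair z' x' y') := by
  rw [forces_isPair] at h ⊢
  intro w q hq
  have h1 : ForcesMem w z' q ↔ ForcesMem w z q :=
    ⟨fun h => h.congr_right (hz.mono hq).symm, fun h => h.congr_right (hz.mono hq)⟩
  rw [h1, h w q hq]
  refine forall₂_congr fun r hr => exists_congr fun s => and_congr_right fun hs => ?_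
  have hs' := hs.trans (hr.trans hq)
  exact or_congr ⟨fun h => h.trans (hx.mono hs'), fun h => h.trans (hx.mono hs').symm⟩
    ⟨fun h => h.trans (hy.mono hs'), fun h => h.trans (hy.mono hs').symm⟩

theorem Forces.isPair_left {z x y : Name P} (h : Forces p (isPair z x y)) : ForcesMem x z p :=
  (forces_isPair.1 h x p le_rfl).2 fun r _ => ⟨r, le_rfl, .inl (.refl _ _)⟩

theorem Forces.isPair_right {z x y : Name P} (h : Forces p (isPair z x y)) : ForcesMem y z p :=
  (forces_isPair.1 h y p le_rfl).2 fun r _ => ⟨r, le_rfl, .inr (.refl _ _)⟩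

theorem Forces.isPair_cases {z x y w : Name P} (h : Forces p (isPair z x y))
    (hq : q ≤ p) (hw : ForcesMem w z p) : ∃ s ≤ q, ForcesEq w x s ∨ ForcesEq w y s :=
  (forces_isPair.1 h w p le_rfl).1 hw q hq

/-- A forced disjunction is decided only after extending. Four successive extensions decide which
member of the other pair each of `x`, `y`, `x'`, `y'` equals. -/
theorem Forces.isPair_inj {z x y x' y' : Name P} (h : Forces p (isPair z x y))
    (h' : Forces p (isPair z x' y')) : ∃ s ≤ p, ForcesEq x x' s ∧ ForcesEq y y' s ∨
      ForcesEq x y' s ∧ ForcesEq y x' s := by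
  obtain ⟨s₁, l₁, h₁⟩ := h'.isPair_cases le_rfl h.isPair_left
  obtain ⟨s₂, l₂, h₂⟩ := h'.isPair_cases l₁ h.isPair_right
  obtain ⟨s₃, l₃, h₃⟩ := h.isPair_cases (l₂.trans l₁) h'.isPair_left
  obtain ⟨s, l₄, h₄⟩ := h.isPair_cases (l₃.trans (l₂.trans l₁)) h'.isPair_right
  refine ⟨s, l₄.trans (l₃.trans (l₂.trans l₁)), ?_⟩
  replace h₁ := h₁.imp (·.mono (l₄.trans (l₃.trans l₂))) (·.mono (l₄.trans (l₃.trans l₂)))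
  replace h₂ := h₂.imp (·.mono (l₄.trans l₃)) (·.mono (l₄.trans l₃))
  replace h₃ := h₃.imp (·.mono l₄) (·.mono l₄)
  rcases h₁ with h₁ | h₁
  · rcases h₂ with h₂ | h₂
    · rcases h₄ with h₄ | h₄
      · exact .inl ⟨h₁, h₂.trans (h₁.symm.trans h₄.symm)⟩
      · exact .inl ⟨h₁, h₄.symm⟩
    · exact .inl ⟨h₁, h₂⟩
  · rcases h₂ with h₂ | h₂
    · exact .inr ⟨h₁, h₂⟩
    · rcases h₃ with h₃ | h₃
      · exact .inl ⟨h₃.symm, h₂⟩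
      · exact .inr ⟨h₁, h₃.symm⟩

theorem forces_isOrdPair {z x y : Name P} : Forces p (isOrdPair z x y) ↔ ∀ q ≤ p, ∃ r ≤ q,
    ∃ a b, Forces r (isPair a x x) ∧ Forces r (isPair b x y) ∧ Forces r (isPair z a b) := by
  rw [isOrdPair, forces_ex]
  constructor
  · intro h q hq
    obtain ⟨r, hr, a, h'⟩ := h q hq
    obtain ⟨s, hs, b, h''⟩ := forces_ex.1 h' r le_rfl
    exact ⟨s, hs.trans hr, a, b, h''⟩
  · intro h q hq
    obtain ⟨r, hr, a, b, h'⟩ := h q hq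
    exact ⟨r, hr, a, .ex h'⟩

theorem Forces.isOrdPair_congr {z x y z' x' y' : Name P} (h : Forces p (isOrdPair z x y))
    (hz : ForcesEq z z' p) (hx : ForcesEq x x' p) (hy : ForcesEq y y' p) :
    Forces p (isOrdPair z' x' y') := by
  rw [forces_isOrdPair] at h ⊢
  intro q hq
  obtain ⟨r, hr, a, b, h₁, h₂, h₃⟩ := h q hq
  have hz := hz.mono (hr.trans hq)
  have hx := hx.mono (hr.trans hq)
  have hy := hy.mono (hr.trans hq)
  exact ⟨r, hr, a, b, h₁.isPair_congr (.refl _ _) hx hx, h₂.isPair_congr (.refl _ _) hx hy,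
    h₃.isPair_congr hz (.refl _ _) (.refl _ _)⟩

theorem Forces.isOrdPair_inj {z x y x' y' : Name P} (h : Forces p (isOrdPair z x y))
    (h' : Forces p (isOrdPair z x' y')) : ForcesEq x x' p ∧ ForcesEq y y' p := by
  change Forces p (conj (eq x x') (eq y y'))
  refine .of_dense fun q hq => ?_
  obtain ⟨r, hr, a, b, h₁, h₂, h₃⟩ := forces_isOrdPair.1 h q hq
  obtain ⟨s, hs, a', b', k₁, k₂, k₃⟩ := forces_isOrdPair.1 h' r (hr.trans hq)
  obtain ⟨t, ht, e⟩ := (h₃.mono hs).isPair_inj k₃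
  replace h₁ := h₁.mono (ht.trans hs)
  replace h₂ := h₂.mono (ht.trans hs)
  replace k₁ := k₁.mono ht
  replace k₂ := k₂.mono ht
  suffices ∃ w ≤ t, ForcesEq x x' w ∧ ForcesEq y y' w by
    obtain ⟨w, hw, e⟩ := this
    exact ⟨w, hw.trans (ht.trans (hs.trans hr)), e⟩
  rcases e with ⟨e₁, e₂⟩ | ⟨e₁, e₂⟩
  · obtain ⟨w, hw, f⟩ := (h₁.isPair_congr e₁ (.refl _ _) (.refl _ _)).isPair_inj k₁
    have f : ForcesEq x x' w := f.elim And.left And.left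
    obtain ⟨w', hw', g⟩ := (h₂.isPair_congr e₂ (.refl _ _) (.refl _ _)).mono hw |>.isPair_inj
      (k₂.mono hw)
    have f := f.mono hw'
    refine ⟨w', hw'.trans hw, f, ?_⟩
    rcases g with g | g
    · exact g.2
    · exact g.2.trans (f.symm.trans g.1)
  -- The crossed case `{x} = {x', y'}`, `{x, y} = {x'}`: all four names become equal.
  · obtain ⟨w, hw, f⟩ := (h₁.isPair_congr e₁ (.refl _ _) (.refl _ _)).isPair_inj k₂
    have f : ForcesEq x x' w ∧ ForcesEq x y' w := f.elim id And.symm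
    obtain ⟨w', hw', g⟩ := (h₂.isPair_congr e₂ (.refl _ _) (.refl _ _)).mono hw |>.isPair_inj
      (k₁.mono hw)
    have f₁ := f.1.mono hw'
    have f₂ := f.2.mono hw'
    refine ⟨w', hw'.trans hw, f₁, ?_⟩
    have g : ForcesEq y x' w' := g.elim And.right And.right
    exact g.trans (f₁.symm.trans f₂)

theorem forces_maps {f x y : Name P} : Forces p (maps f x y) ↔
    ∀ q ≤ p, ∃ r ≤ q, ∃ z, ForcesMem z f r ∧ Forces r (isOrdPair z x y) :=
  forces_exIn

theorem Forces.maps_congr {f x y f' x' y' : Name P} (h : Forces p (maps f x y))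
    (hf : ForcesEq f f' p) (hx : ForcesEq x x' p) (hy : ForcesEq y y' p) :
    Forces p (maps f' x' y') := by
  rw [forces_maps] at h ⊢
  intro q hq
  obtain ⟨r, hr, z, h₁, h₂⟩ := h q hq
  have hr' := hr.trans hq
  exact ⟨r, hr, z, h₁.congr_right (hf.mono hr'),
    h₂.isOrdPair_congr (.refl _ _) (hx.mono hr') (hy.mono hr')⟩

theorem forces_isFun {f A B : Name P} : Forces p (isFun f A B) ↔
    (∀ z, ∀ q ≤ p, ForcesMem z f q → ∃ r ≤ q, ∃ x y, ForcesMem x A r ∧ ForcesMem y B r ∧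
      Forces r (isOrdPair z x y)) ∧
    (∀ x, ∀ q ≤ p, ForcesMem x A q → ∃ r ≤ q, ∃ y, ForcesMem y B r ∧ Forces r (maps f x y)) ∧
    (∀ x y w, ∀ q ≤ p, Forces q (maps f x y) → Forces q (maps f x w) → ForcesEq y w q) := by
  rw [isFun, forces_conj, forces_conj, forces_allIn, forces_allIn]
  refine and_congr ?_ (and_congr ?_ ?_)
  · refine forall_congr' fun z => ⟨fun h q hq hz => ?_, fun h q hq hz => ?_⟩
    · obtain ⟨r, hr, x, hx, h'⟩ := forces_exIn.1 (h q hq hz) q le_rfl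
      obtain ⟨s, hs, y, hy, h''⟩ := forces_exIn.1 h' r le_rfl
      exact ⟨s, hs.trans hr, x, y, hx.mono hs, hy, h''⟩
    · refine forces_exIn.2 fun r hr => ?_
      obtain ⟨s, hs, x, y, hx, hy, h'⟩ := h r (hr.trans hq) (hz.mono hr)
      exact ⟨s, hs, x, hx, .exIn hy h'⟩
  · refine forall_congr' fun x => ⟨fun h q hq hx => ?_, fun h q hq hx => ?_⟩
    · exact forces_exIn.1 (h q hq hx) q le_rfl
    · exact forces_exIn.2 fun r hr => h r (hr.trans hq) (hx.mono hr)
  · simp only [forces_all, forces_imp]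
    refine forall_congr' fun x => forall_congr' fun y => forall_congr' fun w =>
      ⟨fun h q hq h₁ h₂ => h q hq h₁ q le_rfl h₂,
        fun h q hq h₁ r hr h₂ => h r (hr.trans hq) (h₁.mono hr) h₂⟩

/-- The canonical name of the unordered pair of two names. -/
def Name.pair (x y : Name P) : Name P :=
  .mk (ULift.{u} Bool × P) (fun i => if i.1.down then x else y) fun i => i.2

theorem forces_isPair_pair (x y : Name P) (p : P) : Forces p (isPair (.pair x y) x y) := by
  rw [forces_isPair]
  intro w q _
  rw [Name.pair, forcesMem_mk]
  refine forall₂_congr fun r _ => exists_congr fun s => and_congr_right fun _ => ?_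
  constructor
  · rintro ⟨⟨⟨b⟩, t⟩, -, h⟩
    cases b
    · exact .inr h
    · exact .inl h
  · rintro (h | h)
    · exact ⟨(⟨true⟩, s), le_rfl, h⟩
    · exact ⟨(⟨false⟩, s), le_rfl, h⟩

/-- The canonical name of the ordered pair of two names. -/
def Name.ordPair (x y : Name P) : Name P := .pair (.pair x x) (.pair x y)

theorem forces_isOrdPair_ordPair (x y : Name P) (p : P) :
    Forces p (isOrdPair (.ordPair x y) x y) :=
  forces_isOrdPair.2 fun q _ => ⟨q, le_rfl, _, _, forces_isPair_pair _ _ _,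
    forces_isPair_pair _ _ _, forces_isPair_pair _ _ _⟩

end Forces

/-! ### Cardinal arithmetic from `κ ^< κ = κ` -/

/-- By König, `κ < κ ^ cof κ`; a cofinality below `κ` would make this power at most `κ ^< κ = κ`. -/
theorem isRegular_of_powerlt_self {κ : Cardinal.{u}} (hκ : ℵ₀ ≤ κ) (hpow : κ ^< κ = κ) :
    κ.IsRegular := by
  refine ⟨hκ, le_of_not_gt fun h => ?_⟩
  exact (lt_power_cof_ord hκ).not_ge ((le_powerlt κ h).trans_eq hpow)

theorem mk_Iio_ord_toType_lt {κ : Cardinal.{u}} (i : κ.ord.ToType) : #(Set.Iio i) < κ := by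
  simpa using mk_Iio_lt i (by simp)

/-- Each such subset is the range of a function from some ordinal below `κ`, and there are at most
`κ · κ^{<κ} = κ` such functions. -/
theorem mk_small_subsets_le {κ : Cardinal.{u}} (hκ : ℵ₀ ≤ κ) (hpow : κ ^< κ = κ) {X : Type u}
    (hX : #X ≤ κ) : #{t : Set X // #t < κ} ≤ κ := by
  let f : (Σ i : κ.ord.ToType, ((i.toOrd : Ordinal).ToType → X)) → Set X := fun g => Set.range g.2
  have hf : ∀ t : {t : Set X // #t < κ}, ∃ g, f g = t.1 := by
    rintro ⟨t, ht⟩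
    have h : (#t).ord < κ.ord := ord_lt_ord.2 ht
    let i : κ.ord.ToType := Ordinal.ToType.mk ⟨_, h⟩
    have hi : #(i.toOrd : Ordinal).ToType = #t := by simp [i]
    obtain ⟨e⟩ := Cardinal.eq.1 hi
    refine ⟨⟨i, fun x => (e x).1⟩, ?_⟩
    change Set.range (Subtype.val ∘ e) = t
    rw [e.surjective.range_comp, Subtype.range_coe]
  choose g hg using hf
  have hinj : Function.Injective g := fun s t h => Subtype.ext <| by rw [← hg s, ← hg t, h]
  refine (mk_le_of_injective hinj).trans ?_
  rw [mk_sigma]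
  calc
    _ ≤ Cardinal.sum fun _ : κ.ord.ToType => κ := by
      refine sum_le_sum _ _ fun i => ?_
      rw [← power_def]
      have hi : #(i.toOrd : Ordinal).ToType < κ := by
        rw [mk_toType]
        exact lt_ord.1 i.toOrd.2
      exact (power_le_power_right hX).trans ((le_powerlt κ hi).trans_eq hpow)
    _ = κ := by simp [mul_eq_self hκ]

/-! ### Conditions and their supports -/

namespace Fn

variable {κ : Cardinal.{u}} {I J : Type u}

theorem le_def {p q : Fn κ I J} : q ≤ p ↔ p.1 ⊆ q.1 := Iff.rfl

/-- The domain of a condition. -/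
def dom (p : Fn κ I J) : Set I := Prod.fst '' p.1

theorem mk_dom_lt (p : Fn κ I J) : #p.dom < κ := mk_image_le.trans_lt p.2.1

theorem mem_dom {p : Fn κ I J} {i : I} : i ∈ p.dom ↔ ∃ j, (i, j) ∈ p.1 := by
  simp [dom]

/-- The restriction of a condition to a set of indices. -/
def restrict (p : Fn κ I J) (A : Set I) : Fn κ I J :=
  ⟨{x ∈ p.1 | x.1 ∈ A}, (mk_le_mk_of_subset (Set.sep_subset _ _)).trans_lt p.2.1,
    fun i j j' h h' => p.2.2 i j j' h.1 h'.1⟩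

theorem le_restrict (p : Fn κ I J) (A : Set I) : p ≤ p.restrict A := Set.sep_subset _ _

theorem dom_restrict (p : Fn κ I J) (A : Set I) : (p.restrict A).dom = p.dom ∩ A := by
  ext i
  rw [Set.mem_inter_iff, mem_dom, mem_dom]
  exact ⟨fun ⟨j, h⟩ => ⟨⟨j, h.1⟩, h.2⟩, fun ⟨⟨j, h⟩, h'⟩ => ⟨j, h, h'⟩⟩

theorem exists_le_le {p q : Fn κ I J} (hκ : ℵ₀ ≤ κ)
    (h : ∀ i j j', (i, j) ∈ p.1 → (i, j') ∈ q.1 → j = j') :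
    ∃ r ≤ p, r ≤ q ∧ r.dom = p.dom ∪ q.dom := by
  refine ⟨⟨p.1 ∪ q.1, (mk_union_le _ _).trans_lt (add_lt_of_lt hκ p.2.1 q.2.1), ?_⟩,
    Set.subset_union_left, Set.subset_union_right, Set.image_union _ _ _⟩
  rintro i j j' (h₁ | h₁) (h₂ | h₂)
  · exact p.2.2 i j j' h₁ h₂
  · exact h i j j' h₁ h₂
  · exact (h i j' j h₂ h₁).symm
  · exact q.2.2 i j j' h₁ h₂

/-- The condition with a single value. -/
def single (hκ : ℵ₀ ≤ κ) (i : I) (j : J) : Fn κ I J :=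
  ⟨{(i, j)}, by simpa using one_lt_aleph0.trans_le hκ, by
    rintro i j j' h h'
    simp only [Set.mem_singleton_iff, Prod.mk.injEq] at h h'
    rw [h.2, h'.2]⟩

theorem le_single {hκ : ℵ₀ ≤ κ} {i : I} {j : J} {p : Fn κ I J} :
    p ≤ single hκ i j ↔ (i, j) ∈ p.1 :=
  Set.singleton_subset_iff

theorem exists_le_single (hκ : ℵ₀ ≤ κ) {p : Fn κ I J} {i : I} (hi : i ∉ p.dom) (j : J) :
    ∃ q ≤ p, q ≤ single hκ i j := by
  obtain ⟨q, h, h', -⟩ := exists_le_le (p := p) (q := single hκ i j) hκ (by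
    intro i' j₁ j₂ h₁ h₂
    simp only [single, Set.mem_singleton_iff, Prod.mk.injEq] at h₂
    exact (hi (h₂.1 ▸ mem_dom.2 ⟨_, h₁⟩)).elim)
  exact ⟨q, h, h'⟩

theorem mk_dom_subset_le (hκ : ℵ₀ ≤ κ) (hpow : κ ^< κ = κ) (hJ : #J ≤ κ) {S : Set I}
    (hS : #S ≤ κ) : #{p : Fn κ I J // p.dom ⊆ S} ≤ κ := by
  let f : S × J → I × J := Prod.map Subtype.val id
  have hf : f.Injective := Subtype.val_injective.prodMap Function.injective_id
  have hX : #(S × J) ≤ κ := by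
    rw [mk_prod, lift_id, lift_id]
    exact mul_le_of_le hκ hS hJ
  refine le_trans ?_ (mk_small_subsets_le hκ hpow hX)
  refine mk_le_of_injective
    (f := fun p => ⟨f ⁻¹' p.1.1, (mk_preimage_of_injective _ _ hf).trans_lt p.1.2.1⟩) ?_
  have key (p : {p : Fn κ I J // p.dom ⊆ S}) : f '' (f ⁻¹' p.1.1) = p.1.1 := by
    refine Set.image_preimage_eq_of_subset ?_
    rintro ⟨i, j⟩ h
    exact ⟨(⟨i, p.2 (mem_dom.2 ⟨j, h⟩)⟩, j), rfl⟩
  intro p q h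
  refine Subtype.ext (Subtype.ext ?_)
  rw [← key p, ← key q, (Subtype.mk.inj h : f ⁻¹' p.1.1 = f ⁻¹' q.1.1)]

/-- The stages of the closure of `∅` under `p ↦ dom (e p)`. -/
inductive Stage (e : Fn κ I J → Fn κ I J) : κ.ord.ToType → I → Prop
  | intro {i k : κ.ord.ToType} (hik : i < k) (p : Fn κ I J) (hp : ∀ x ∈ p.dom, Stage e i x)
      (x : I) (hx : x ∈ (e p).dom) : Stage e k x

theorem Stage.mono {e : Fn κ I J → Fn κ I J} {i k : κ.ord.ToType} {x : I} (h : Stage e i x)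
    (hik : i ≤ k) : Stage e k x := by
  cases h with
  | intro h p hp _ hx => exact .intro (h.trans_le hik) p hp x hx

/-- Stage `k` is covered by fewer than `κ` earlier stages; each carries at most `κ` conditions, and
each of these contributes fewer than `κ` indices. -/
theorem mk_stage_le (hκ : ℵ₀ ≤ κ) (hpow : κ ^< κ = κ) (hJ : #J ≤ κ) (e : Fn κ I J → Fn κ I J)
    (k : κ.ord.ToType) : #{x | Stage e k x} ≤ κ := by
  induction k using WellFoundedLT.induction with
  | ind k ih =>
    have hsub : {x | Stage e k x} ⊆ ⋃ i : Set.Iio k,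
        ⋃ p : {p : Fn κ I J // p.dom ⊆ {x | Stage e i x}}, (e p.1).dom := by
      rintro x ⟨hik, p, hp, _, hx⟩
      exact Set.mem_iUnion.2 ⟨⟨_, hik⟩, Set.mem_iUnion.2 ⟨⟨p, hp⟩, hx⟩⟩
    refine (mk_le_mk_of_subset hsub).trans ((mk_iUnion_le _).trans ?_)
    refine mul_le_of_le hκ (mk_Iio_ord_toType_lt k).le (ciSup_le' fun i => ?_)
    refine (mk_iUnion_le _).trans (mul_le_of_le hκ ?_ (ciSup_le' fun p => (mk_dom_lt _).le))
    exact mk_dom_subset_le hκ hpow hJ (ih i.1 i.2)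

/-- Every set `E` of conditions has a set `A` of at most `κ` indices such that every condition with
an extension in `E` is compatible with an element of `E` whose domain is a subset of `A`. -/
theorem exists_support (hκ : ℵ₀ ≤ κ) (hpow : κ ^< κ = κ) (hJ : #J ≤ κ) (E : Set (Fn κ I J)) :
    ∃ A : Set I, #A ≤ κ ∧ ∀ r : Fn κ I J, (∃ e ∈ E, e ≤ r) →
      ∃ e ∈ E, ∃ s ≤ r, s ≤ e ∧ s.dom ⊆ r.dom ∪ A := by
  have hreg := isRegular_of_powerlt_self hκ hpow
  -- Choose for every `r` an extension `e r` in `E`; if there is none, `e r = r` is a harmless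
  -- default.
  have : ∀ r : Fn κ I J, ∃ e, (∃ e ∈ E, e ≤ r) → e ∈ E ∧ e ≤ r := fun r => by
    by_cases h : ∃ e ∈ E, e ≤ r
    · exact ⟨h.choose, fun _ => h.choose_spec⟩
    · exact ⟨r, fun h' => (h h').elim⟩
  choose e he using this
  refine ⟨⋃ k, {x | Stage e k x}, ?_, fun r ⟨e₀, he₀, hr⟩ => ?_⟩
  · refine (mk_iUnion_le _).trans (mul_le_of_le hκ (by simp) (ciSup_le' fun k => ?_))
    exact mk_stage_le hκ hpow hJ e k
  · set A := ⋃ k, {x | Stage e k x} with hA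
    set r' := r.restrict A
    obtain ⟨h₁, h₂⟩ := he r' ⟨e₀, he₀, hr.trans (r.le_restrict A)⟩
    have hst : ∀ x : r'.dom, ∃ k, Stage e k x := by
      rintro ⟨x, hx⟩
      rw [dom_restrict] at hx
      simpa [hA] using hx.2
    choose k hk using hst
    -- The domain of `r'` has fewer than `κ` elements, so by regularity it already lies in one stage
    -- `k₀`. The domain of `e r'` then enters at the next stage.
    have hsup : ⨆ x, ((k x).toOrd : Ordinal) < κ.ord :=
      Ordinal.iSup_lt_of_lt_cof (hreg.cof_ord.symm ▸ r'.mk_dom_lt) fun x => (k x).toOrd.2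
    have hsup' := (isSuccLimit_ord hκ).succ_lt hsup
    let k₀ : κ.ord.ToType := Ordinal.ToType.mk ⟨_, hsup⟩
    let k₁ : κ.ord.ToType := Ordinal.ToType.mk ⟨_, hsup'⟩
    have hlt : k₀ < k₁ := by
      simp only [k₀, k₁, OrderIso.lt_iff_lt]
      exact Order.lt_succ (⨆ x, ((k x).toOrd : Ordinal))
    have hdom : (e r').dom ⊆ A := fun x hx => by
      refine Set.mem_iUnion.2 ⟨k₁, .intro hlt r' (fun y hy => (hk ⟨y, hy⟩).mono ?_) x hx⟩
      rw [← Ordinal.ToType.mk.symm.le_iff_le]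
      simp only [k₀, OrderIso.symm_apply_apply]
      exact Ordinal.le_iSup (fun x => ((k x).toOrd : Ordinal)) _
    -- An index common to `r` and `e r'` lies in `A`, where `r` agrees with `r'`, which `e r'`
    -- extends. Hence the two are compatible.
    obtain ⟨s, hs₁, hs₂, hs₃⟩ := exists_le_le (p := r) (q := e r') hκ fun i j j' h h' => by
      have hi : i ∈ A := hdom (mem_dom.2 ⟨_, h'⟩)
      exact (e r').2.2 i j j' (h₂ ⟨h, hi⟩) h'
    exact ⟨_, h₁, s, hs₁, hs₂, hs₃.subset.trans (Set.union_subset_union_right _ hdom)⟩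

end Fn

open SetFormula Name

theorem exists_toOrd_eq {a o : Ordinal.{u}} (h : a < o) :
    ∃ i : o.ToType, (i.toOrd : Ordinal) = a :=
  ⟨Ordinal.ToType.mk ⟨a, h⟩, by simp⟩

/-! ### Cohen generic functions -/

section Generic

variable {κ : Cardinal.{u}} {N : Type u}

/-- The name of the generic function `κ → κ` with index `γ`. -/
noncomputable def genericFun (hκ : ℵ₀ ≤ κ) (γ : N) :
    Name (Fn κ (N × κ.ord.ToType) κ.ord.ToType) :=
  .mk (κ.ord.ToType × κ.ord.ToType)
    (fun x => .ordPair (ordName _ (x.1.toOrd : Ordinal)) (ordName _ (x.2.toOrd : Ordinal)))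
    fun x => .single hκ (γ, x.1) x.2

variable {hκ : ℵ₀ ≤ κ} {γ : N} {p : Fn κ (N × κ.ord.ToType) κ.ord.ToType}

theorem exists_of_forcesMem_genericFun
    {z : Name (Fn κ (N × κ.ord.ToType) κ.ord.ToType)} (h : ForcesMem z (genericFun hκ γ) p) :
    ∃ r ≤ p, ∃ β δ : κ.ord.ToType, ((γ, β), δ) ∈ r.1 ∧
      Forces r (isOrdPair z (ordName _ (β.toOrd : Ordinal)) (ordName _ (δ.toOrd : Ordinal))) := by
  obtain ⟨r, hr, ⟨β, δ⟩, h₁, h₂⟩ := forcesMem_mk.1 h p le_rfl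
  exact ⟨r, hr, β, δ, Fn.le_single.1 h₁,
    (forces_isOrdPair_ordPair _ _ r).isOrdPair_congr h₂.symm (.refl _ _) (.refl _ _)⟩

theorem exists_of_forces_maps_genericFun
    {x y : Name (Fn κ (N × κ.ord.ToType) κ.ord.ToType)}
    (h : Forces p (maps (genericFun hκ γ) x y)) :
    ∃ r ≤ p, ∃ β δ : κ.ord.ToType, ((γ, β), δ) ∈ r.1 ∧
      ForcesEq x (ordName _ (β.toOrd : Ordinal)) r ∧
      ForcesEq y (ordName _ (δ.toOrd : Ordinal)) r := by
  obtain ⟨r, hr, z, hz, h'⟩ := forces_maps.1 h p le_rfl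
  obtain ⟨s, hs, β, δ, h₁, h₂⟩ := exists_of_forcesMem_genericFun hz
  exact ⟨s, hs.trans hr, β, δ, h₁, (h'.mono hs).isOrdPair_inj h₂⟩

theorem forces_maps_genericFun {β δ : κ.ord.ToType} (h : ((γ, β), δ) ∈ p.1) :
    Forces p (maps (genericFun hκ γ) (ordName _ (β.toOrd : Ordinal))
      (ordName _ (δ.toOrd : Ordinal))) :=
  forces_maps.2 fun q hq => ⟨q, le_rfl, _,
    forcesMem_elt (β, δ) (Fn.le_single.2 (Fn.le_def.1 hq h)), forces_isOrdPair_ordPair _ _ _⟩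

/-- Totality is a density argument; single-valuedness holds because conditions are functions. -/
theorem forces_isFun_genericFun (hκ : ℵ₀ ≤ κ) (γ : N)
    (p : Fn κ (N × κ.ord.ToType) κ.ord.ToType) :
    Forces p (isFun (genericFun hκ γ) (ordName _ κ.ord) (ordName _ κ.ord)) := by
  refine forces_isFun.2 ⟨fun z q _ hz => ?_, fun x q _ hx => ?_, fun x y w q _ hy hw => ?_⟩
  · obtain ⟨r, hr, β, δ, -, h⟩ := exists_of_forcesMem_genericFun hz
    exact ⟨r, hr, _, _, forcesMem_ordName_of_lt β.toOrd.2 r,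
      forcesMem_ordName_of_lt δ.toOrd.2 r, h⟩
  · obtain ⟨r, hr, b, hb, hxb⟩ := forcesMem_ordName.1 hx q le_rfl
    obtain ⟨β, rfl⟩ := exists_toOrd_eq hb
    obtain ⟨s, hs, δ, hδ⟩ : ∃ s ≤ r, ∃ δ, ((γ, β), δ) ∈ s.1 := by
      by_cases h : (γ, β) ∈ r.dom
      · exact ⟨r, le_rfl, Fn.mem_dom.1 h⟩
      -- Any value would do; `β` is an element of `κ` at hand.
      · obtain ⟨s, hs, h'⟩ := Fn.exists_le_single hκ h β
        exact ⟨s, hs, β, Fn.le_single.1 h'⟩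
    exact ⟨s, hs.trans hr, _, forcesMem_ordName_of_lt δ.toOrd.2 s,
      (forces_maps_genericFun hδ).maps_congr (.refl _ _) (hxb.mono hs).symm (.refl _ _)⟩
  · refine .of_dense fun r hr => ?_
    obtain ⟨s, hs, β, δ, h₁, h₂, h₃⟩ := exists_of_forces_maps_genericFun (hy.mono hr)
    obtain ⟨t, ht, β', δ', k₁, k₂, k₃⟩ :=
      exists_of_forces_maps_genericFun (hw.mono (hs.trans hr))
    obtain rfl : β = β' := by
      have := ((h₂.mono ht).symm.trans k₂).ordName_inj
      exact Ordinal.ToType.mk.symm.injective (Subtype.ext this)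
    obtain rfl : δ = δ' := t.2.2 _ _ _ (Fn.le_def.1 ht h₁) k₁
    exact ⟨t, ht.trans hs, (h₃.mono ht).trans k₃.symm⟩

/-- No condition `p` forces `g ≤* f` for the generic function `g` with index `γ`, if every `r ≤ p`
with `(γ, β)` outside its domain has an extension of this kind that decides `f(β)`. -/
theorem not_forces_leStar_genericFun {f : Name (Fn κ (N × κ.ord.ToType) κ.ord.ToType)}
    (hf : ∀ r ≤ p, ∀ β : κ.ord.ToType, (γ, β) ∉ r.dom → ∃ s ≤ r, (γ, β) ∉ s.dom ∧
      ∃ d < κ.ord, Forces s (maps f (ordName _ (β.toOrd : Ordinal)) (ordName _ d))) :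
    ¬ Forces p (leStar (ordName _ κ.ord) (genericFun hκ γ) f) := by
  intro h
  obtain ⟨q, hq, α, hα, h⟩ := forces_exIn.1 h p le_rfl
  obtain ⟨r, hr, a, ha, hαa⟩ := forcesMem_ordName.1 hα q le_rfl
  -- The ordinals up to `a` and the second coordinates occurring in `r.dom` are two sets of size
  -- less than `κ`, so they do not cover `κ`.
  obtain ⟨β, hβ, hβr⟩ : ∃ β : κ.ord.ToType, a < β.toOrd ∧ (γ, β) ∉ r.dom := by
    by_contra! hc
    have hsub : Set.univ ⊆ {β : κ.ord.ToType | β.toOrd < Order.succ a} ∪ Prod.snd '' r.dom := by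
      intro β _
      by_cases hβ : a < β.toOrd
      · exact .inr ⟨_, hc β hβ, rfl⟩
      · exact .inl (Order.lt_succ_iff.2 (not_lt.1 hβ))
    have ha' := (isSuccLimit_ord hκ).succ_lt ha
    have h₁ : #{β : κ.ord.ToType | β.toOrd < Order.succ a} < κ := by
      have : {β : κ.ord.ToType | β.toOrd < Order.succ a} =
          Set.Iio (Ordinal.ToType.mk ⟨_, ha'⟩) := by
        ext β
        rw [Set.mem_Iio, ← Ordinal.ToType.mk.symm.lt_iff_lt, OrderIso.symm_apply_apply]
        rfl
      rw [this]
      exact mk_Iio_ord_toType_lt _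
    have h₂ := (mk_le_mk_of_subset hsub).trans (mk_union_le _ _)
    rw [mk_univ, mk_ord_toType] at h₂
    exact h₂.not_gt (add_lt_of_lt hκ h₁ (mk_image_le.trans_lt r.mk_dom_lt))
  obtain ⟨s, hs, hβs, d, hd, hfd⟩ := hf r (hr.trans hq) β hβr
  -- The value `δ = d + 1` will violate `g(β) ≤ f(β) = d`; it is below `κ` because `κ` is a limit.
  obtain ⟨δ, hδ⟩ := exists_toOrd_eq ((isSuccLimit_ord hκ).succ_lt hd)
  obtain ⟨t, ht, ht'⟩ := Fn.exists_le_single hκ hβs δ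
  have hg := forces_maps_genericFun (hκ := hκ) (Fn.le_single.1 ht')
  rw [hδ] at hg
  have hmem : ForcesMem α (ordName _ (β.toOrd : Ordinal)) t :=
    (forcesMem_ordName_of_lt hβ t).congr_left (hαa.mono (ht.trans hs)).symm
  have h := forces_imp.1 (forces_allIn.1 h _ t (ht.trans (hs.trans hr))
    (forcesMem_ordName_of_lt β.toOrd.2 t)) t le_rfl hmem
  have h := forces_imp.1 (forces_imp.1 (forces_all.1 (forces_all.1 h _) _) t le_rfl hg) t le_rfl
    (hfd.mono ht)
  obtain ⟨w, -, h | h⟩ := forces_disj.1 h t le_rfl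
  · exact (Order.le_succ d).not_gt (ForcesMem.lt_of_ordName h)
  · exact (Order.lt_succ d).ne' (ForcesEq.ordName_inj h)

end Generic

/-! ### Small families are not dominating -/

/-- A function from an ordinal `a` to `κ^κ` has an index not mentioned in the supports of its
values, if the set of indices has more than `#a` and more than `κ` elements. -/
theorem exists_index_off_supports {κ : Cardinal.{u}} (hκ : ℵ₀ ≤ κ) {N ι : Type u} (hN : κ < #N)
    (hι : #ι < #N) (A : ι → κ.ord.ToType → Set (N × κ.ord.ToType)) (hA : ∀ i β, #(A i β) ≤ κ) :
    ∃ γ, ∀ i β β', (γ, β') ∉ A i β := by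
  by_contra! h
  have hsub : Set.univ ⊆ ⋃ x : ι × κ.ord.ToType, Prod.fst '' A x.1 x.2 := by
    intro γ _
    obtain ⟨i, β, β', h⟩ := h γ
    exact Set.mem_iUnion.2 ⟨(i, β), _, h, rfl⟩
  have h' := (mk_le_mk_of_subset hsub).trans (mk_iUnion_le _)
  rw [mk_univ] at h'
  refine h'.not_gt (mul_lt_of_lt (hκ.trans hN.le) ?_
    ((ciSup_le' fun x => mk_image_le.trans (hA _ _)).trans_lt hN))
  rw [mk_prod, lift_id, lift_id, mk_ord_toType]
  exact mul_lt_of_lt (hκ.trans hN.le) hι hN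

theorem not_forces_isDominating {κ : Cardinal.{u}} (hκ : ℵ₀ ≤ κ) (hpow : κ ^< κ = κ)
    {N : Type u} (hN : κ < #N) {a : Ordinal.{u}} (ha : a.card < #N)
    {p : Fn κ (N × κ.ord.ToType) κ.ord.ToType}
    {D h : Name (Fn κ (N × κ.ord.ToType) κ.ord.ToType)}
    (hfun : ∀ x y w, ∀ q ≤ p, Forces q (maps h x y) → Forces q (maps h x w) → ForcesEq y w q)
    (hsurj : Forces p (allIn D fun y => exIn (ordName _ a) fun x => maps h x y)) :
    ¬ Forces p (isDominating (ordName _ κ.ord) D) := by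
  intro hdom
  -- The conditions deciding `h(i)(β)`. The name `f` may vary with the condition, so that `E i β`
  -- depends only on `h`, `i`, `β` and `γ` can be chosen before the dominating `f` is known.
  let E (i : a.ToType) (β : κ.ord.ToType) : Set (Fn κ (N × κ.ord.ToType) κ.ord.ToType) :=
    {e | ∃ f, ∃ d < κ.ord, Forces e (maps h (ordName _ (i.toOrd : Ordinal)) f) ∧
      Forces e (maps f (ordName _ (β.toOrd : Ordinal)) (ordName _ d))}
  choose A hA hAE using fun i β => Fn.exists_support hκ hpow (by simp) (E i β)
  obtain ⟨γ, hγ⟩ := exists_index_off_supports hκ hN (by simpa using ha) A hA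
  have hg := forces_imp.1 (forces_all.1 hdom.2 (genericFun hκ γ)) p le_rfl
    (forces_isFun_genericFun hκ γ p)
  obtain ⟨p₁, hp₁, f, hfD, hle⟩ := forces_exIn.1 hg p le_rfl
  -- Since `h` maps onto `D`, an extension decides an ordinal `i` with `h(i) = f`.
  obtain ⟨p₂, hp₂, x, hx, hxf⟩ := forces_exIn.1 (forces_allIn.1 hsurj f p₁ hp₁ hfD) p₁ le_rfl
  obtain ⟨p₃, hp₃, b, hb, hxb⟩ := forcesMem_ordName.1 hx p₂ le_rfl
  obtain ⟨i, rfl⟩ := exists_toOrd_eq hb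
  have hif := (hxf.mono hp₃).maps_congr (.refl _ _) hxb (.refl _ _)
  have hp₃₁ := hp₃.trans hp₂
  refine not_forces_leStar_genericFun (p := p₃) (fun r hr β hβ => ?_) (hle.mono hp₃₁)
  have hfun' := forces_isFun.1 (forces_allIn.1 hdom.1 f p₁ hp₁ hfD)
  have hrE : ∃ e ∈ E i β, e ≤ r := by
    obtain ⟨s, hs, y, hy, hfy⟩ := hfun'.2.1 _ r (hr.trans hp₃₁)
      (forcesMem_ordName_of_lt (a := β.toOrd) β.toOrd.2 r)
    obtain ⟨t, ht, d, hd, hyd⟩ := forcesMem_ordName.1 hy s le_rfl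
    exact ⟨t, ⟨f, d, hd, hif.mono (ht.trans (hs.trans hr)),
      (hfy.mono ht).maps_congr (.refl _ _) (.refl _ _) hyd⟩, ht.trans hs⟩
  obtain ⟨e, ⟨f', d, hd, h₁, h₂⟩, s, hs, hse, hsdom⟩ := hAE i β r hrE
  refine ⟨s, hs, fun hc => (hsdom hc).elim hβ (hγ i β β), d, hd, ?_⟩
  -- The name `f'` supplied by `e` need not be `f`, but `s` forces both to be `h(i)`, hence equal.
  have hsp : s ≤ p := hs.trans (hr.trans (hp₃₁.trans hp₁))
  exact (h₂.mono hse).maps_congr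
    (hfun _ _ _ s hsp (h₁.mono hse) (hif.mono (hs.trans hr))) (.refl _ _) (.refl _ _)

end KappaCohen

theorem lemma2p3 (κ ν : Cardinal.{u}) (hκ : ℵ₀ ≤ κ) (hpow : κ ^< κ = κ) (hν : κ < ν) :
    KappaCohen.PosetForces
      (KappaCohen.Fn κ (ν.ord.ToType × κ.ord.ToType) κ.ord.ToType)
      (KappaCohen.SetFormula.dominatingNumberGE
        (KappaCohen.cardName _ κ) (KappaCohen.cardName _ ν)) := by
  intro p₀ D
  refine KappaCohen.forces_imp.2 fun p hp hdom q hq hlt => ?_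
  obtain ⟨r, hr, θ, hθ, hlt⟩ := KappaCohen.forces_exIn.1 hlt q le_rfl
  obtain ⟨s, hs, h, hfun, hsurj⟩ := KappaCohen.forces_ex.1 hlt r le_rfl
  -- The name `θ` of an ordinal below `ν` is decided to be a ground-model ordinal `a`, whose
  -- cardinality is less than `ν`.
  obtain ⟨t, ht, a, ha, hθa⟩ := KappaCohen.Name.forcesMem_ordName.1 hθ s hs
  have htp := ht.trans (hs.trans (hr.trans hq))
  refine KappaCohen.not_forces_isDominating hκ hpow (by simpa using hν)
    (by simpa using lt_ord.1 ha) (D := D) (h := h) (p := t) ?_ ?_ (hdom.mono htp)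
  · exact fun x y w u hu => (KappaCohen.forces_isFun.1 hfun).2.2 x y w u (hu.trans ht)
  · refine KappaCohen.forces_allIn.2 fun y u hu hy => KappaCohen.forces_exIn.2 fun v hv => ?_
    obtain ⟨w, hw, x, hx, hxy⟩ := KappaCohen.forces_exIn.1
      (KappaCohen.forces_allIn.1 (hsurj.mono ht) y u hu hy) v hv
    exact ⟨w, hw, x, hx.congr_right (hθa.mono (hw.trans (hv.trans hu))), hxy⟩
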